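/- Let $k$ be a field and let $B$ be an (associative, unital, not necessarily commutative) $k$-algebra. Let $B\text{-}\mathrm{Mod}$ be the category of all left $B$-modules and let $B\text{-}\mathrm{mod}_{fd}$ be its full abelian subcategory of modules that are finite-dimensional over $k$. Let $D^b(B\text{-}\mathrm{mod}_{fd})$ be the bounded derived category of $B\text{-}\mathrm{mod}_{fd}$, and let $D^b_{fd}(B\text{-}\mathrm{Mod})$ be the full subcategory of the derived category $D(B\text{-}\mathrm{Mod})$ whose objects have bounded cohomology and all of whose cohomology modules are finite-dimensional over $k$. The exact inclusion $B\text{-}\mathrm{mod}_{fd}\to B\text{-}\mathrm{Mod}$ induces a canonical functor $$\Phi\colon D^b(B\text{-}\mathrm{mod}_{fd})\longrightarrow D^b_{fd}(B\text{-}\mathrm{Mod})$$ and, for all finite-dimensional $B$-modules $M,N$ and all $n\ge 0$, canonical maps $$\varphi^n_{M,N}\colon \mathrm{Ext}^n_{B\text{-}\mathrm{mod}_{fd}}(M,N)\longrightarrow \mathrm{Ext}^n_{B\text{-}\mathrm{Mod}}(M,N),$$ where each $\mathrm{Ext}^n$ is taken in the indicated abelian category. The following four assertions are equivalent: 1. $\Phi$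 is an equivalence of categories. 2. $\Phi$ is essentially surjective. 3. For all finite-dimensional $B$-modules $M,N$ and all $n\ge 1$, the map $\varphi^n_{M,N}$ is bijective. 4. For all finite-dimensional $B$-modules $M,N$ and all $n\ge 2$, the map $\varphi^n_{M,N}$ is surjective. (The algebra $B$ is called *good* if it satisfies these equivalent assertions.) -/

import Mathlib

open CategoryTheory Limits Abelian

universe w u

namespace FinDimMod

noncomputable section

section

open scoped ModuleCat

variable (k : Type w) [Field k] (B : Type u) [Ring B] [Algebra k B]

/-- The left `B`-modules that are finite-dimensional over `k`, as a property of objects of the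
category `ModuleCat B` of all left `B`-modules. The `k`-vector space structure of a `B`-module
is the one obtained by restriction of scalars along `algebraMap k B`. -/
def isFinDim : ObjectProperty (ModuleCat.{u} B) :=
  fun M => FiniteDimensional k M

variable {B} in
/-- A morphism of `B`-modules, as a `k`-linear map. -/
def toLin {M N : ModuleCat.{u} B} (f : M ⟶ N) : M →ₗ[k] N :=
  f.hom.restrictScalars k

instance isFinDim_isClosedUnderSubobjects : (isFinDim k B).IsClosedUnderSubobjects where
  prop_of_mono f _ hN := by
    have : Module.Finite k _ := hN
    exact Module.Finite.of_injective (toLin k f) ((ModuleCat.mono_iff_injective f).1 ‹_›)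

instance isFinDim_isClosedUnderQuotients : (isFinDim k B).IsClosedUnderQuotients where
  prop_of_epi f _ hM := by
    have : Module.Finite k _ := hM
    exact Module.Finite.of_surjective (toLin k f) ((ModuleCat.epi_iff_surjective f).1 ‹_›)

instance isFinDim_containsZero : (isFinDim k B).ContainsZero where
  exists_zero := by
    have : Finite (ModuleCat.of B PUnit.{u + 1}) := inferInstanceAs (Finite PUnit.{u + 1})
    exact ⟨ModuleCat.of B PUnit, ModuleCat.isZero_of_subsingleton _,
      (Module.Finite.of_finite : Module.Finite k (ModuleCat.of B PUnit.{u + 1}))⟩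

instance isFinDim_isClosedUnderExtensions : (isFinDim k B).IsClosedUnderExtensions where
  prop_X₂_of_shortExact {S} hS h₁ h₃ := by
    have : Module.Finite k S.X₁ := h₁
    have : Module.Finite k S.X₃ := h₃
    have hfg : Function.Exact (toLin k S.f) (toLin k S.g) :=
      (ShortComplex.ShortExact.moduleCat_exact_iff_function_exact S).1 hS.exact
    have := hS.epi_g
    exact Module.Finite.of_exact hfg ((ModuleCat.epi_iff_surjective S.g).1 ‹_›)

instance isFinDim_isSerreClass : (isFinDim k B).IsSerreClass where

instance isFinDim_isClosedUnderFiniteProducts : (isFinDim k B).IsClosedUnderFiniteProducts := by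
  have : (isFinDim k B).IsClosedUnderBinaryProducts :=
    { limitsOfShape_le := by
        rintro X ⟨p⟩
        refine (isFinDim k B).prop_of_iso ?_ ((isFinDim k B).prop_biprod
          (p.prop_diag_obj (.mk .left)) (p.prop_diag_obj (.mk .right)))
        exact biprod.isoProd _ _ ≪≫ IsLimit.conePointUniqueUpToIso (prodIsProd _ _)
          ((IsLimit.postcomposeHomEquiv (diagramIsoPair p.diag) _).2 p.isLimit) }
  exact .mk'

/-- The abelian category of left `B`-modules that are finite-dimensional over `k`, a full
subcategory of `ModuleCat B`. -/
abbrev FDMod : Type (u + 1) := (isFinDim k B).FullSubcategory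

/-- The inclusion of finite-dimensional modules into all modules. -/
abbrev incl : FDMod k B ⥤ ModuleCat.{u} B := (isFinDim k B).ι

instance incl_preservesFiniteLimits : PreservesFiniteLimits (incl k B) := by
  have := (isFinDim k B).preservesKernels_ι
  exact (incl k B).preservesFiniteLimits_of_preservesKernels

instance incl_preservesFiniteColimits : PreservesFiniteColimits (incl k B) := by
  have := (isFinDim k B).preservesCokernels_ι
  exact (incl k B).preservesFiniteColimits_of_preservesCokernels

/-- The derived category of the category of all left `B`-modules, as the localization of the
category of cochain complexes at the quasi-isomorphisms. -/
instance modHasDerivedCategory : HasDerivedCategory.{u + 1} (ModuleCat.{u} B) := HasDerivedCategory.standard _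

/-- The derived category of the category of finite-dimensional left `B`-modules, as the
localization of the category of cochain complexes at the quasi-isomorphisms. -/
instance fdModHasDerivedCategory : HasDerivedCategory.{u + 1} (FDMod k B) := HasDerivedCategory.standard _

instance fdModHasExt : HasExt.{u + 1} (FDMod k B) := HasExt.standard _

/-- The functor `D(B-mod_fd) ⥤ D(B-Mod)` induced by the exact inclusion functor. -/
def derivedIncl : DerivedCategory (FDMod k B) ⥤ DerivedCategory (ModuleCat.{u} B) :=
  (incl k B).mapDerivedCategory

/-- The bounded objects of `D(B-Mod)` all of whose cohomology modules are finite-dimensional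
over `k`. -/
def isBoundedFD : ObjectProperty (DerivedCategory (ModuleCat.{u} B)) :=
  fun X => DerivedCategory.TStructure.t.bounded X ∧
    ∀ n : ℤ, isFinDim k B ((DerivedCategory.homologyFunctor (ModuleCat.{u} B) n).obj X)

/-- The full subcategory `D^b_fd(B-Mod)` of `D(B-Mod)`. -/
abbrev BoundedFD : Type (u + 1) := (isBoundedFD k B).FullSubcategory

lemma nonempty_homology_iso (X : DerivedCategory (FDMod k B)) (n : ℤ) :
    Nonempty ((DerivedCategory.homologyFunctor (ModuleCat.{u} B) n).obj
        ((derivedIncl k B).obj X) ≅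
      (incl k B).obj ((DerivedCategory.homologyFunctor (FDMod k B) n).obj X)) := by
  let K := DerivedCategory.Q.objPreimage X
  let e : DerivedCategory.Q.obj K ≅ X := DerivedCategory.Q.objObjPreimageIso X
  exact ⟨(DerivedCategory.homologyFunctor _ n).mapIso
      ((derivedIncl k B).mapIso e.symm ≪≫ (incl k B).mapDerivedCategoryFactors.app K) ≪≫
    (DerivedCategory.homologyFunctorFactors _ n).app _ ≪≫
    (K.sc n).mapHomologyIso (incl k B) ≪≫
    (incl k B).mapIso ((DerivedCategory.homologyFunctorFactors _ n).symm.app K ≪≫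
      (DerivedCategory.homologyFunctor _ n).mapIso e)⟩

lemma isBoundedFD_derivedIncl_obj (X : DerivedCategory.Bounded (FDMod k B)) :
    isBoundedFD k B ((derivedIncl k B).obj X.obj) := by
  refine ⟨?_, fun n => ?_⟩
  · obtain ⟨⟨a, ha⟩, ⟨b, hb⟩⟩ := X.property
    refine ⟨⟨a, (DerivedCategory.isGE_iff _ _).2 fun i hi => ?_⟩,
      ⟨b, (DerivedCategory.isLE_iff _ _).2 fun i hi => ?_⟩⟩
    · obtain ⟨e⟩ := nonempty_homology_iso k B X.obj i
      exact ((incl k B).map_isZero ((DerivedCategory.isGE_iff _ _).1 ha i hi)).of_iso e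
    · obtain ⟨e⟩ := nonempty_homology_iso k B X.obj i
      exact ((incl k B).map_isZero ((DerivedCategory.isLE_iff _ _).1 hb i hi)).of_iso e
  · obtain ⟨e⟩ := nonempty_homology_iso k B X.obj n
    exact (isFinDim k B).prop_of_iso e.symm
      ((DerivedCategory.homologyFunctor (FDMod k B) n).obj X.obj).property

/-- The canonical functor `D^b(B-mod_fd) ⥤ D^b_fd(B-Mod)`. -/
def boundedIncl : DerivedCategory.Bounded (FDMod k B) ⥤ BoundedFD k B :=
  (isBoundedFD k B).lift (DerivedCategory.Bounded.ι ⋙ derivedIncl k B)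
    (isBoundedFD_derivedIncl_obj k B)

/-- The canonical map from the `Ext` groups of the category of finite-dimensional modules to those
of the category of all modules, induced by the inclusion functor. -/
def extMap (M N : FDMod k B) (n : ℕ) :
    Ext.{u + 1} M N n →+ Ext.{u} ((incl k B).obj M) ((incl k B).obj N) n :=
  (incl k B).mapExtAddHom M N n

end

end

end FinDimMod

/-!
Write `F` for the exact, fully faithful inclusion of finite-dimensional modules into all modules,
`Φ` for the induced triangulated functor on derived categories, and `φⁿ` for the maps on `Extⁿ`.
Under the identification of `Extⁿ(M, N)` with morphisms `M ⟶ N⟦n⟧` in the derived category, `φⁿ` is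
`Φ` (`exists_equiv_comp_mapExtAddHom`). Apart from the last section, the argument only uses that `F`
is exact and fully faithful with essential image closed under extensions.

*Surjectivity in degrees `≥ 2` implies bijectivity.* The map `φ⁰` is bijective because `F` is fully
faithful, and `φ¹` is surjective because the essential image of `F` is closed under extensions
(`surjective_map_one`). An Ext class of positive degree is killed by some epimorphism `P ⟶ M`
(`exists_epi_mk₀_comp_eq_zero`), so by dimension shifting `φⁿ⁺¹` is injective as soon as `φⁿ` is
bijective (`injective_mapExtAddHom_succ`).

*Bijectivity on Ext implies that `Φ` is an equivalence.* A bounded object is an iterated extension,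
by truncation triangles, of objects placed in a single degree (`bounded_induction`). Full
faithfulness follows by the five lemma (`bijective_map_of_bounded`). Essential surjectivity follows
by lifting the connecting morphisms of the truncation triangles (`exists_bounded_iso`).

*Essential surjectivity implies surjectivity in degrees `≥ 2`.* For `f : M ⟶ N⟦n⟧`, consider the
distinguished triangle `N⟦n - 1⟧ ⟶ Z ⟶ M ⟶ N⟦n⟧`. If `n ≥ 2`, it is a truncation triangle of `Z`,
and `Z` is bounded with finite-dimensional cohomology, so that `Z ≅ Φ X`. By uniqueness of
truncations, `f` is the image of the connecting morphism of a truncation triangle of `X`, up to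
isomorphisms between objects concentrated in a single degree, which lift since `F` is full
(`surjective_map_of_exists_iso`).
-/

namespace FinDimMod

/-! ### Bijectivity on morphisms for triangulated functors -/

section HomBijective

open Pretriangulated

universe v₁ v₂ u₁ u₂

variable {T : Type u₁} [Category.{v₁} T] {T' : Type u₂} [Category.{v₂} T'] (G : T ⥤ T')

lemma surjective_map_of_iso {X X' Y Y' : T} (e : X ≅ X') (e' : Y ≅ Y')
    (h : Function.Surjective (G.map (X := X) (Y := Y))) :
    Function.Surjective (G.map (X := X') (Y := Y')) := by
  intro g
  obtain ⟨f, hf⟩ := h (G.map e.hom ≫ g ≫ G.map e'.inv)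
  refine ⟨e.inv ≫ f ≫ e'.hom, ?_⟩
  simp [hf]

lemma injective_map_of_iso {X X' Y Y' : T} (e : X ≅ X') (e' : Y ≅ Y')
    (h : Function.Injective (G.map (X := X) (Y := Y))) :
    Function.Injective (G.map (X := X') (Y := Y')) := by
  intro f g hfg
  have : e.hom ≫ f ≫ e'.inv = e.hom ≫ g ≫ e'.inv := h (by simp [hfg])
  simpa using this

lemma bijective_map_of_iso {X X' Y Y' : T} (e : X ≅ X') (e' : Y ≅ Y')
    (h : Function.Bijective (G.map (X := X) (Y := Y))) :
    Function.Bijective (G.map (X := X') (Y := Y')) :=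
  ⟨injective_map_of_iso G e e' h.1, surjective_map_of_iso G e e' h.2⟩

lemma bijective_map_shift [HasShift T ℤ] [HasShift T' ℤ] [G.CommShift ℤ] {X Y : T}
    (h : Function.Bijective (G.map (X := X) (Y := Y))) (a : ℤ) :
    Function.Bijective (G.map (X := X⟦a⟧) (Y := Y⟦a⟧)) := by
  have hf : (shiftFunctor T a).FullyFaithful := .ofFullyFaithful _
  have hf' : (shiftFunctor T' a).FullyFaithful := .ofFullyFaithful _
  constructor
  · intro f g hfg
    obtain ⟨f, rfl⟩ := hf.map_surjective f
    obtain ⟨g, rfl⟩ := hf.map_surjective g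
    congr 1
    apply h.1
    apply hf'.map_injective
    have h₁ := (G.commShiftIso a).hom.naturality f
    have h₂ := (G.commShiftIso a).hom.naturality g
    dsimp at h₁ h₂
    rw [hfg, h₂] at h₁
    exact ((cancel_epi _).1 h₁).symm
  · intro f
    obtain ⟨g, hg⟩ := hf'.map_surjective
      ((G.commShiftIso a).inv.app X ≫ f ≫ (G.commShiftIso a).hom.app Y)
    obtain ⟨g, rfl⟩ := h.2 g
    refine ⟨g⟦a⟧', ?_⟩
    have h₁ := (G.commShiftIso a).hom.naturality g
    dsimp at h₁
    rw [hg] at h₁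
    rw [← cancel_mono ((G.commShiftIso a).hom.app Y)]
    simpa using h₁

variable [HasShift T ℤ]

/-- `G` induces bijections `Hom(X⟦a⟧, Y⟦b⟧) → Hom(G (X⟦a⟧), G (Y⟦b⟧))` for all integers `a`
and `b`. Including all the shifts makes this condition stable under extensions in `X` and in `Y`. -/
def ShiftedHomBijective (X Y : T) : Prop :=
  ∀ a b : ℤ, Function.Bijective (G.map (X := X⟦a⟧) (Y := Y⟦b⟧))

variable {G} in
lemma ShiftedHomBijective.bijective {X Y : T} (h : ShiftedHomBijective G X Y) :
    Function.Bijective (G.map (X := X) (Y := Y)) :=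
  bijective_map_of_iso G ((shiftFunctorZero T ℤ).app X) ((shiftFunctorZero T ℤ).app Y) (h 0 0)

variable {G} in
lemma ShiftedHomBijective.of_iso {X X' Y Y' : T} (h : ShiftedHomBijective G X Y)
    (e : X ≅ X') (e' : Y ≅ Y') : ShiftedHomBijective G X' Y' := fun a b =>
  bijective_map_of_iso G ((shiftFunctor T a).mapIso e) ((shiftFunctor T b).mapIso e') (h a b)

variable {G} in
lemma ShiftedHomBijective.map_shift_left {X Y : T} (h : ShiftedHomBijective G X Y) (a b c : ℤ) :
    Function.Bijective (G.map (X := X⟦a⟧⟦c⟧) (Y := Y⟦b⟧)) :=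
  bijective_map_of_iso G ((shiftFunctorAdd T a c).app X) (Iso.refl _) (h (a + c) b)

variable {G} in
lemma ShiftedHomBijective.map_shift_right {X Y : T} (h : ShiftedHomBijective G X Y) (a b c : ℤ) :
    Function.Bijective (G.map (X := X⟦a⟧) (Y := Y⟦b⟧⟦c⟧)) :=
  bijective_map_of_iso G (Iso.refl _) ((shiftFunctorAdd T b c).app Y) (h a (b + c))

variable [Preadditive T] [HasZeroObject T]
  [∀ n : ℤ, (shiftFunctor T n).Additive] [Pretriangulated T]
  [Preadditive T'] [HasZeroObject T'] [HasShift T' ℤ]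
  [∀ n : ℤ, (shiftFunctor T' n).Additive] [Pretriangulated T']
  [G.CommShift ℤ] [G.IsTriangulated]

lemma exists_distinguished_inv_rot {X₁ X₂ X₃ : T} {f : X₁ ⟶ X₂} {g : X₂ ⟶ X₃} {h : X₃ ⟶ X₁⟦(1 : ℤ)⟧}
    (hΔ : Triangle.mk f g h ∈ distTriang T) :
    ∃ (d : X₃⟦(-1 : ℤ)⟧ ⟶ X₁) (e : X₂ ⟶ X₃⟦(-1 : ℤ)⟧⟦(1 : ℤ)⟧), Triangle.mk d f e ∈ distTriang T :=
  ⟨_, _, inv_rot_of_distTriang _ hΔ⟩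

lemma map_distinguished_mk {X₁ X₂ X₃ : T} {f : X₁ ⟶ X₂} {g : X₂ ⟶ X₃} {h : X₃ ⟶ X₁⟦(1 : ℤ)⟧}
    (hΔ : Triangle.mk f g h ∈ distTriang T) :
    Triangle.mk (G.map f) (G.map g) (G.map h ≫ (G.commShiftIso (1 : ℤ)).hom.app X₁) ∈
      distTriang T' :=
  G.map_distinguished _ hΔ

/-- The five lemma for the maps `Hom(-, Y) → Hom(G -, G Y)` along a distinguished triangle. -/
lemma bijective_map_obj₂_left {X₁ X₂ X₃ : T} {u : X₁ ⟶ X₂} {v : X₂ ⟶ X₃} {w : X₃ ⟶ X₁⟦(1 : ℤ)⟧}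
    (hΔ : Triangle.mk u v w ∈ distTriang T) (Y : T)
    (h₁ : Function.Bijective (G.map (X := X₁) (Y := Y)))
    (h₃ : Function.Bijective (G.map (X := X₃) (Y := Y)))
    (h₁' : Function.Surjective (G.map (X := X₁⟦(1 : ℤ)⟧) (Y := Y)))
    (h₃' : Function.Injective (G.map (X := X₃⟦(-1 : ℤ)⟧) (Y := Y))) :
    Function.Bijective (G.map (X := X₂) (Y := Y)) := by
  have huv : u ≫ v = 0 := comp_distTriang_mor_zero₁₂ _ hΔ
  have hvw : v ≫ w = 0 := comp_distTriang_mor_zero₂₃ _ hΔ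
  have hG := map_distinguished_mk G hΔ
  constructor
  · refine (injective_iff_map_eq_zero (G.mapAddHom (X := X₂) (Y := Y))).2 fun f hf => ?_
    replace hf : G.map f = 0 := hf
    obtain ⟨g, hg⟩ : ∃ g : X₃ ⟶ Y, f = v ≫ g :=
      Triangle.yoneda_exact₂ _ hΔ f (show u ≫ f = 0 from h₁.1 (by simp [hf]))
    obtain ⟨t, ht⟩ : ∃ t, G.map g = (G.map w ≫ (G.commShiftIso (1 : ℤ)).hom.app X₁) ≫ t :=
      Triangle.yoneda_exact₃ _ hG (G.map g)
        (show G.map v ≫ G.map g = 0 by rw [← G.map_comp, ← hg, hf])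
    obtain ⟨s, hs⟩ := h₁' ((G.commShiftIso (1 : ℤ)).hom.app _ ≫ t)
    have : g = w ≫ s := h₃.1 (by simpa [hs] using ht)
    rw [hg, this, reassoc_of% hvw, zero_comp]
  · intro f
    obtain ⟨g, hg⟩ := h₁.2 (G.map u ≫ f)
    obtain ⟨d, e, hr⟩ := exists_distinguished_inv_rot hΔ
    have hdu : d ≫ u = 0 := comp_distTriang_mor_zero₁₂ _ hr
    obtain ⟨s, hs⟩ : ∃ s : X₂ ⟶ Y, g = u ≫ s :=
      Triangle.yoneda_exact₂ _ hr g (show d ≫ g = 0 from h₃' (by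
        rw [G.map_comp, hg, ← G.map_comp_assoc, hdu]; simp))
    obtain ⟨t, ht⟩ : ∃ t, f - G.map s = G.map v ≫ t :=
      Triangle.yoneda_exact₂ _ hG (f - G.map s)
        (show G.map u ≫ (f - G.map s) = 0 by rw [Preadditive.comp_sub, ← hg, hs]; simp)
    obtain ⟨r, rfl⟩ := h₃.2 t
    exact ⟨s + v ≫ r, by rw [G.map_add, G.map_comp, ← ht]; abel⟩

/-- The five lemma for the maps `Hom(X, -) → Hom(G X, G -)` along a distinguished triangle. -/
lemma bijective_map_obj₂_right {X₁ X₂ X₃ : T} {u : X₁ ⟶ X₂} {v : X₂ ⟶ X₃}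
    {w : X₃ ⟶ X₁⟦(1 : ℤ)⟧} (hΔ : Triangle.mk u v w ∈ distTriang T) (X : T)
    (h₁ : Function.Bijective (G.map (X := X) (Y := X₁)))
    (h₃ : Function.Bijective (G.map (X := X) (Y := X₃)))
    (h₁' : Function.Injective (G.map (X := X) (Y := X₁⟦(1 : ℤ)⟧)))
    (h₃' : Function.Surjective (G.map (X := X) (Y := X₃⟦(-1 : ℤ)⟧))) :
    Function.Bijective (G.map (X := X) (Y := X₂)) := by
  have huv : u ≫ v = 0 := comp_distTriang_mor_zero₁₂ _ hΔ
  have hvw : v ≫ w = 0 := comp_distTriang_mor_zero₂₃ _ hΔ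
  have hG := map_distinguished_mk G hΔ
  obtain ⟨d, e, hr⟩ := exists_distinguished_inv_rot hΔ
  have hdu : d ≫ u = 0 := comp_distTriang_mor_zero₁₂ _ hr
  have hGr := map_distinguished_mk G hr
  constructor
  · refine (injective_iff_map_eq_zero (G.mapAddHom (X := X) (Y := X₂))).2 fun f hf => ?_
    replace hf : G.map f = 0 := hf
    obtain ⟨g, hg⟩ : ∃ g : X ⟶ X₁, f = g ≫ u :=
      Triangle.coyoneda_exact₂ _ hΔ f (show f ≫ v = 0 from h₃.1 (by simp [hf]))
    obtain ⟨t, ht⟩ : ∃ t, G.map g = t ≫ G.map d :=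
      Triangle.coyoneda_exact₂ _ hGr (G.map g)
        (show G.map g ≫ G.map u = 0 by rw [← G.map_comp, ← hg, hf])
    obtain ⟨s, rfl⟩ := h₃' t
    have : g = s ≫ d := h₁.1 (by rw [G.map_comp, ht])
    rw [hg, this, Category.assoc, hdu, comp_zero]
  · intro f
    obtain ⟨g, hg⟩ := h₃.2 (f ≫ G.map v)
    obtain ⟨s, hs⟩ : ∃ s : X ⟶ X₂, g = s ≫ v :=
      Triangle.coyoneda_exact₃ _ hΔ g (show g ≫ w = 0 from h₁' (by
        rw [G.map_comp, hg, Category.assoc, ← G.map_comp, hvw]; simp))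
    obtain ⟨t, ht⟩ : ∃ t, f - G.map s = t ≫ G.map u :=
      Triangle.coyoneda_exact₂ _ hG (f - G.map s)
        (show (f - G.map s) ≫ G.map v = 0 by rw [Preadditive.sub_comp, ← hg, hs]; simp)
    obtain ⟨r, rfl⟩ := h₁.2 t
    exact ⟨s + r ≫ u, by rw [G.map_add, G.map_comp, ← ht]; abel⟩

variable {G}

lemma exists_distinguished_shift {X₁ X₂ X₃ : T} {f : X₁ ⟶ X₂} {g : X₂ ⟶ X₃}
    {h : X₃ ⟶ X₁⟦(1 : ℤ)⟧} (hΔ : Triangle.mk f g h ∈ distTriang T) (a : ℤ) :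
    ∃ (u : X₁⟦a⟧ ⟶ X₂⟦a⟧) (v : X₂⟦a⟧ ⟶ X₃⟦a⟧) (w : X₃⟦a⟧ ⟶ X₁⟦a⟧⟦(1 : ℤ)⟧),
      Triangle.mk u v w ∈ distTriang T :=
  ⟨_, _, _, Triangle.shift_distinguished _ hΔ a⟩

lemma ShiftedHomBijective.obj₂_left {X₁ X₂ X₃ : T} {u : X₁ ⟶ X₂} {v : X₂ ⟶ X₃}
    {w : X₃ ⟶ X₁⟦(1 : ℤ)⟧} (hΔ : Triangle.mk u v w ∈ distTriang T) {Y : T}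
    (h₁ : ShiftedHomBijective G X₁ Y) (h₃ : ShiftedHomBijective G X₃ Y) :
    ShiftedHomBijective G X₂ Y := fun a b => by
  obtain ⟨u, v, w, hΔ'⟩ := exists_distinguished_shift hΔ a
  exact bijective_map_obj₂_left G hΔ' _ (h₁ a b) (h₃ a b) (h₁.map_shift_left a b 1).2
    (h₃.map_shift_left a b (-1)).1

lemma ShiftedHomBijective.obj₂_right {X₁ X₂ X₃ : T} {u : X₁ ⟶ X₂} {v : X₂ ⟶ X₃}
    {w : X₃ ⟶ X₁⟦(1 : ℤ)⟧} (hΔ : Triangle.mk u v w ∈ distTriang T) {X : T}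
    (h₁ : ShiftedHomBijective G X X₁) (h₃ : ShiftedHomBijective G X X₃) :
    ShiftedHomBijective G X X₂ := fun a b => by
  obtain ⟨u, v, w, hΔ'⟩ := exists_distinguished_shift hΔ b
  exact bijective_map_obj₂_right G hΔ' _ (h₁ a b) (h₃ a b) (h₁.map_shift_right a b 1).1
    (h₃.map_shift_right a b (-1)).2

end HomBijective

/-! ### Cohomology and bounded objects of derived categories -/

section Homology

open Pretriangulated DerivedCategory DerivedCategory.TStructure

universe w₁ v₁ u₁

variable {A : Type u₁} [Category.{v₁} A] [Abelian A] [HasDerivedCategory.{w₁} A]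

/-- Along the truncation triangle `X₁ → X₂ → X₃`, with `X₁` in degrees `≤ a` and `X₃` in degrees
`≥ b = a + 1`, the cohomology of `X₂` is that of `X₁` in degrees `≤ a` and that of `X₃` in
degrees `≥ b`. -/
lemma homology_mem_iff_of_distinguished (S : ObjectProperty A) [S.ContainsZero]
    [S.IsClosedUnderIsomorphisms] {X₁ X₂ X₃ : DerivedCategory A} {f : X₁ ⟶ X₂} {g : X₂ ⟶ X₃}
    {h : X₃ ⟶ X₁⟦(1 : ℤ)⟧} (hΔ : Triangle.mk f g h ∈ distTriang _) (a b : ℤ) (hab : a + 1 = b)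
    [X₁.IsLE a] [X₃.IsGE b] :
    (∀ i, S ((homologyFunctor A i).obj X₂)) ↔
      (∀ i, S ((homologyFunctor A i).obj X₁)) ∧ ∀ i, S ((homologyFunctor A i).obj X₃) := by
  have h₁ (i : ℤ) (hi : i ≤ a) :
      Nonempty ((homologyFunctor A i).obj X₁ ≅ (homologyFunctor A i).obj X₂) := by
    have : Mono ((homologyFunctor A i).map f) :=
      (HomologySequence.mono_homologyMap_mor₁_iff _ hΔ (i - 1) i (by lia)).2
        ((X₃.isZero_of_isGE b (i - 1) (by lia)).eq_of_src _ _)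
    have : Epi ((homologyFunctor A i).map f) :=
      (HomologySequence.epi_homologyMap_mor₁_iff _ hΔ i).2
        ((X₃.isZero_of_isGE b i (by lia)).eq_of_tgt _ _)
    have := isIso_of_mono_of_epi ((homologyFunctor A i).map f)
    exact ⟨asIso ((homologyFunctor A i).map f)⟩
  have h₃ (i : ℤ) (hi : b ≤ i) :
      Nonempty ((homologyFunctor A i).obj X₂ ≅ (homologyFunctor A i).obj X₃) := by
    have : Epi ((homologyFunctor A i).map g) :=
      (HomologySequence.epi_homologyMap_mor₂_iff _ hΔ i (i + 1) (by lia)).2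
        ((X₁.isZero_of_isLE a (i + 1) (by lia)).eq_of_tgt _ _)
    have : Mono ((homologyFunctor A i).map g) :=
      (HomologySequence.mono_homologyMap_mor₂_iff _ hΔ i).2
        ((X₁.isZero_of_isLE a i (by lia)).eq_of_src _ _)
    have := isIso_of_mono_of_epi ((homologyFunctor A i).map g)
    exact ⟨asIso ((homologyFunctor A i).map g)⟩
  refine ⟨fun h₂ => ⟨fun i => ?_, fun i => ?_⟩, fun ⟨h, h'⟩ i => ?_⟩
  · by_cases hi : i ≤ a
    · exact S.prop_of_iso (h₁ i hi).some.symm (h₂ i)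
    · exact S.prop_of_isZero (X₁.isZero_of_isLE a i (by lia))
  · by_cases hi : b ≤ i
    · exact S.prop_of_iso (h₃ i hi).some (h₂ i)
    · exact S.prop_of_isZero (X₃.isZero_of_isGE b i (by lia))
  · by_cases hi : i ≤ a
    · exact S.prop_of_iso (h₁ i hi).some (h i)
    · exact S.prop_of_iso (h₃ i (by lia)).some.symm (h' i)

lemma homology_singleFunctor_obj_mem (S : ObjectProperty A) [S.ContainsZero]
    [S.IsClosedUnderIsomorphisms] {M : A} (hM : S M) (n i : ℤ) :
    S ((homologyFunctor A i).obj ((singleFunctor A n).obj M)) := by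
  obtain hi | rfl | hi := lt_trichotomy i n
  · exact S.prop_of_isZero (isZero_of_isGE _ n i hi)
  · exact S.prop_of_iso ((singleFunctorCompHomologyFunctorIso A i).app M).symm hM
  · exact S.prop_of_isZero (isZero_of_isLE _ n i hi)

/-- Dévissage: a property of objects of the derived category that is stable under isomorphisms and
extensions holds for all bounded objects with cohomology in `S` as soon as it holds for all the
objects of `S` placed in a single degree. -/
lemma bounded_induction (S : ObjectProperty A) [S.ContainsZero] [S.IsClosedUnderIsomorphisms]
    (P : ObjectProperty (DerivedCategory A)) [P.IsClosedUnderIsomorphisms]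
    (hP : ∀ (n : ℤ) (M : A), S M → P ((singleFunctor A n).obj M))
    (hP' : ∀ {X₁ X₂ X₃ : DerivedCategory A} (f : X₁ ⟶ X₂) (g : X₂ ⟶ X₃) (h : X₃ ⟶ X₁⟦(1 : ℤ)⟧),
      Triangle.mk f g h ∈ distTriang _ → P X₁ → P X₃ → P X₂)
    (X : DerivedCategory A) (hX : t.bounded X) (hX' : ∀ i, S ((homologyFunctor A i).obj X)) :
    P X := by
  have key (m : ℕ) : ∀ (a : ℤ) (X : DerivedCategory A) (_ : X.IsGE a) (_ : X.IsLE (a + m)),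
      (∀ i, S ((homologyFunctor A i).obj X)) → P X := by
    induction m with
    | zero =>
      intro a X _ hX hS
      rw [Nat.cast_zero, add_zero] at hX
      obtain ⟨M, ⟨e⟩⟩ := exists_iso_singleFunctor_obj_of_isGE_of_isLE X a
      exact P.prop_of_iso e.symm (hP a M (S.prop_of_iso ((homologyFunctor A a).mapIso e ≪≫
        (singleFunctorCompHomologyFunctorIso A a).app M) (hS a)))
    | succ m hm =>
      intro a X _ hX hS
      -- split off the top degree `b = a + m + 1`
      obtain ⟨b, hb⟩ : ∃ b, a + m + 1 = b := ⟨_, rfl⟩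
      have hb' : a + (m + 1 : ℕ) = b := by push_cast; lia
      rw [hb'] at hX
      have hΔ := t.triangleLTGE_distinguished b X
      have : DerivedCategory.IsLE ((t.truncLT b).obj X) (a + m) := t.isLE_truncLT_obj _ _ _
      have : DerivedCategory.IsGE ((t.truncGE b).obj X) b := inferInstance
      have : DerivedCategory.IsLE ((t.truncGE b).obj X) b := inferInstance
      have : DerivedCategory.IsGE ((t.truncLT b).obj X) a := inferInstance
      have hS' := (homology_mem_iff_of_distinguished S hΔ (a + m) b hb).1 hS
      refine hP' _ _ _ hΔ (hm a _ inferInstance inferInstance hS'.1) ?_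
      obtain ⟨M, ⟨e⟩⟩ := exists_iso_singleFunctor_obj_of_isGE_of_isLE ((t.truncGE b).obj X) b
      exact P.prop_of_iso e.symm (hP b M (S.prop_of_iso ((homologyFunctor A b).mapIso e ≪≫
        (singleFunctorCompHomologyFunctorIso A b).app M) (hS'.2 b)))
  obtain ⟨⟨a, ha⟩, ⟨b, hb⟩⟩ := hX
  exact key (b - a).toNat a X ha (t.isLE_of_le X b _ (by lia)) hX'

end Homology

/-! ### Effaceability of Ext classes -/

section Effaceable

open DerivedCategory

universe w' v

variable {A : Type u} [Category.{v} A] [Abelian A]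

/-- A quasi-isomorphism from a complex in degrees `≤ 0` to an object in degree `0` is an epimorphism
in degree `0`, since the degree `0` cohomology is a quotient of the degree `0` term. -/
lemma epi_f_zero_of_quasiIso {K : CochainComplex A ℤ} [K.IsStrictlyLE 0] {X : A}
    (s : K ⟶ (HomologicalComplex.single A (ComplexShape.up ℤ) 0).obj X) [QuasiIso s] :
    Epi (s.f 0) := by
  let L := (HomologicalComplex.single A (ComplexShape.up ℤ) 0).obj X
  have : IsIso (K.iCycles 0) := K.isIso_iCycles 0 1 (by simp)
    ((K.isZero_of_isStrictlyLE 0 1 (by lia)).eq_of_tgt _ _)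
  have : IsIso (L.iCycles 0) := L.isIso_iCycles 0 1 (by simp) (by simp [L])
  have : IsIso (L.homologyπ 0) := L.isIso_homologyπ (-1) 0 (by simp) (by simp [L])
  have h : K.iCycles 0 ≫ s.f 0 = K.homologyπ 0 ≫ HomologicalComplex.homologyMap s 0 ≫
      inv (L.homologyπ 0) ≫ L.iCycles 0 := by
    rw [HomologicalComplex.homologyπ_naturality_assoc, IsIso.hom_inv_id_assoc,
      HomologicalComplex.cyclesMap_i]
  have : Epi (K.iCycles 0 ≫ s.f 0) := by
    rw [h]
    infer_instance
  exact epi_of_epi (K.iCycles 0) (s.f 0)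

/-- For a quasi-isomorphism `s : K → X` from a complex in degrees `≤ 0`, the epimorphism `K⁰ → X` in
degree `0` lifts to a morphism of complexes `K⁰ → K`. -/
lemma exists_epi_single_map_eq {K : CochainComplex A ℤ} [K.IsStrictlyLE 0] {X : A}
    (s : K ⟶ (HomologicalComplex.single A (ComplexShape.up ℤ) 0).obj X) [QuasiIso s] :
    ∃ (P : A) (j : (HomologicalComplex.single A (ComplexShape.up ℤ) 0).obj P ⟶ K) (p : P ⟶ X)
      (_ : Epi p), (HomologicalComplex.single A (ComplexShape.up ℤ) 0).map p = j ≫ s := by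
  let j : (HomologicalComplex.single A (ComplexShape.up ℤ) 0).obj (K.X 0) ⟶ K :=
    HomologicalComplex.mkHomFromSingle (𝟙 _)
      (fun k hk => (K.isZero_of_isStrictlyLE 0 k (by simp at hk; lia)).eq_of_tgt _ _)
  obtain ⟨p, hp⟩ := (HomologicalComplex.single A (ComplexShape.up ℤ) 0).map_surjective (j ≫ s)
  refine ⟨K.X 0, j, p, ?_, hp⟩
  have h := HomologicalComplex.congr_hom hp 0
  rw [HomologicalComplex.single_map_f_self, HomologicalComplex.comp_f,
    HomologicalComplex.mkHomFromSingle_f, Category.comp_id, Iso.cancel_iso_hom_left] at h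
  have := epi_f_zero_of_quasiIso s
  have : Epi (p ≫ (HomologicalComplex.singleObjXSelf (ComplexShape.up ℤ) 0 X).inv) := by
    rw [h]
    infer_instance
  exact (epi_comp_iff_of_isIso p _).1 this

/-- A morphism from `X` to an object in strictly negative degrees is killed by some epimorphism
onto `X`: if it is represented by a fraction `X ← K → L` with `K` in degrees `≤ 0`, then `K⁰ → X` is
such an epimorphism. -/
lemma exists_epi_singleFunctor_map_comp_eq_zero [HasDerivedCategory.{w} A] {X Y : A} (m : ℤ)
    (hm : m < 0) (f : (singleFunctor A 0).obj X ⟶ (singleFunctor A m).obj Y) :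
    ∃ (P : A) (p : P ⟶ X) (_ : Epi p), (singleFunctor A 0).map p ≫ f = 0 := by
  obtain ⟨K, _, s, hs, g, hf⟩ := right_fac_of_isStrictlyLE
    (X := (CochainComplex.singleFunctor A 0).obj X)
    (Y := (CochainComplex.singleFunctor A m).obj Y) f 0
  have hs' : QuasiIso s := by rwa [← isIso_Q_map_iff_quasiIso]
  obtain ⟨P, j, p, _, hp⟩ : ∃ (P : A) (j : (CochainComplex.singleFunctor A 0).obj P ⟶ K)
      (p : P ⟶ X) (_ : Epi p), (CochainComplex.singleFunctor A 0).map p = j ≫ s :=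
    @exists_epi_single_map_eq _ _ _ _ _ X s hs'
  have hj : j ≫ g = 0 :=
    HomologicalComplex.from_single_hom_ext
      ((HomologicalComplex.isZero_single_obj_X _ _ _ _ (by lia)).eq_of_tgt _ _)
  have h : Q.map (j ≫ s) ≫ inv (Q.map s) ≫ Q.map g = 0 := by
    rw [Q.map_comp, Category.assoc, IsIso.hom_inv_id_assoc, ← Q.map_comp, hj, Q.map_zero]
  rw [← hp] at h
  exact ⟨P, p, ‹_›, by rw [hf]; exact h⟩

variable [HasExt.{w} A]

/-- An Ext class of positive degree is killed by some epimorphism onto its source. -/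
lemma exists_epi_mk₀_comp_eq_zero {X Y : A} {n : ℕ} (ξ : Ext X Y (n + 1)) :
    ∃ (P : A) (p : P ⟶ X) (_ : Epi p), (Ext.mk₀ p).comp ξ (zero_add (n + 1)) = 0 := by
  let := HasDerivedCategory.standard A
  let e : ((singleFunctor A 0).obj Y)⟦((n + 1 : ℕ) : ℤ)⟧ ≅ (singleFunctor A (-(n + 1 : ℕ))).obj Y :=
    ((singleFunctors A).shiftIso (n + 1 : ℕ) (-(n + 1 : ℕ)) 0 (by lia)).app Y
  obtain ⟨P, p, hp, h⟩ := exists_epi_singleFunctor_map_comp_eq_zero _ (by lia) (ξ.hom ≫ e.hom)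
  refine ⟨P, p, hp, ?_⟩
  ext
  rw [← Ext.singleFunctor_map_comp_hom, Ext.zero_hom, ← cancel_mono e.hom, Category.assoc, h,
    zero_comp]

variable {B : Type*} [Category* B] [Abelian B] [HasExt.{w'} B] (F : A ⥤ B) [F.Additive]
  [PreservesFiniteLimits F] [PreservesFiniteColimits F]

/-- If an exact functor induces bijections on `Ext^n`, then it induces injections
on `Ext^(n + 1)`. -/
lemma injective_mapExtAddHom_succ (n : ℕ)
    (h : ∀ X Y : A, Function.Bijective (F.mapExtAddHom X Y n)) (X Y : A) :
    Function.Injective (F.mapExtAddHom X Y (n + 1)) := by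
  refine (injective_iff_map_eq_zero _).2 fun ξ hξ => ?_
  obtain ⟨P, p, _, hp⟩ := exists_epi_mk₀_comp_eq_zero ξ
  let S := ShortComplex.mk _ _ (kernel.condition p)
  have hS : S.ShortExact := { exact := ShortComplex.exact_kernel p }
  obtain ⟨η, rfl⟩ := Ext.contravariant_sequence_exact₃ hS Y ξ hp (add_comm 1 n)
  obtain ⟨ζ, hζ⟩ := Ext.contravariant_sequence_exact₁ (hS.map_of_exact F) (F.obj Y)
    (η.mapExactFunctor F) (add_comm 1 n)
    (by
      rw [← Ext.mapExactFunctor_extClass F hS]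
      exact (Ext.mapExactFunctor_comp F _ _ _).symm.trans hξ)
  obtain ⟨ζ, rfl⟩ := (h _ _).2 ζ
  have : η = (Ext.mk₀ S.f).comp ζ (zero_add n) := (h _ _).1 (by
    rw [Functor.mapExtAddHom_coe, Ext.mapExactFunctor_comp, Ext.mapExactFunctor_mk₀]
    exact hζ.symm)
  rw [this, hS.extClass_comp_assoc]

end Effaceable

/-! ### The functor induced by an exact functor on derived categories -/

section MapDerivedCategory

open Pretriangulated DerivedCategory DerivedCategory.TStructure

universe w₁' w₂' w₁ w₂ v₁ v₂ u₁ u₂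

variable {A : Type u₁} [Category.{v₁} A] [Abelian A] [HasDerivedCategory.{w₁} A]
  {B : Type u₂} [Category.{v₂} B] [Abelian B] [HasDerivedCategory.{w₂} B]
  (F : A ⥤ B) [F.Additive] [PreservesFiniteLimits F] [PreservesFiniteColimits F]

lemma nonempty_homology_mapDerivedCategory_obj_iso (X : DerivedCategory A) (n : ℤ) :
    Nonempty ((homologyFunctor B n).obj (F.mapDerivedCategory.obj X) ≅
      F.obj ((homologyFunctor A n).obj X)) := by
  let K := Q.objPreimage X
  let e : Q.obj K ≅ X := Q.objObjPreimageIso X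
  exact ⟨(homologyFunctor _ n).mapIso
      (F.mapDerivedCategory.mapIso e.symm ≪≫ F.mapDerivedCategoryFactors.app K) ≪≫
    (homologyFunctorFactors _ n).app _ ≪≫ (K.sc n).mapHomologyIso F ≪≫
    F.mapIso ((homologyFunctorFactors _ n).symm.app K ≪≫ (homologyFunctor _ n).mapIso e)⟩

lemma isLE_mapDerivedCategory_obj (X : DerivedCategory A) (n : ℤ) [X.IsLE n] :
    (F.mapDerivedCategory.obj X).IsLE n :=
  (isLE_iff _ _).2 fun i hi =>
    (F.map_isZero (X.isZero_of_isLE n i hi)).of_iso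
      (nonempty_homology_mapDerivedCategory_obj_iso F X i).some

lemma isGE_mapDerivedCategory_obj (X : DerivedCategory A) (n : ℤ) [X.IsGE n] :
    (F.mapDerivedCategory.obj X).IsGE n :=
  (isGE_iff _ _).2 fun i hi =>
    (F.map_isZero (X.isZero_of_isGE n i hi)).of_iso
      (nonempty_homology_mapDerivedCategory_obj_iso F X i).some

omit [HasDerivedCategory.{w₁} A] [Abelian B] [HasDerivedCategory.{w₂} B] [F.Additive]
  [PreservesFiniteLimits F] [PreservesFiniteColimits F] in
lemma isZero_of_isZero_obj [HasZeroMorphisms B] [F.Faithful] {X : A} (h : IsZero (F.obj X)) :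
    IsZero X :=
  (IsZero.iff_id_eq_zero _).2 (F.map_injective (h.eq_of_src _ _))

lemma isLE_of_isLE_mapDerivedCategory_obj [F.Faithful] (X : DerivedCategory A) (n : ℤ)
    [(F.mapDerivedCategory.obj X).IsLE n] : X.IsLE n :=
  (isLE_iff _ _).2 fun i hi => isZero_of_isZero_obj F
    ((isZero_of_isLE (F.mapDerivedCategory.obj X) n i hi).of_iso
      (nonempty_homology_mapDerivedCategory_obj_iso F X i).some.symm)

lemma isGE_of_isGE_mapDerivedCategory_obj [F.Faithful] (X : DerivedCategory A) (n : ℤ)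
    [(F.mapDerivedCategory.obj X).IsGE n] : X.IsGE n :=
  (isGE_iff _ _).2 fun i hi => isZero_of_isZero_obj F
    ((isZero_of_isGE (F.mapDerivedCategory.obj X) n i hi).of_iso
      (nonempty_homology_mapDerivedCategory_obj_iso F X i).some.symm)

section Ext

variable [HasExt.{w₁'} A] [HasExt.{w₂'} B]

/-- The map induced by `F` on `Ext^n(X, Y)` is, up to the identification of Ext groups with groups
of morphisms in derived categories, the map induced by `F.mapDerivedCategory`. -/
lemma exists_equiv_comp_mapExtAddHom (X Y : A) (n : ℕ) :
    ∃ e : (F.mapDerivedCategory.obj ((singleFunctor A 0).obj X) ⟶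
        F.mapDerivedCategory.obj (((singleFunctor A 0).obj Y)⟦(n : ℤ)⟧)) ≃
        Ext (F.obj X) (F.obj Y) n,
      F.mapExtAddHom X Y n = e ∘ F.mapDerivedCategory.map ∘ Ext.homEquiv := by
  let e := (Iso.homCongr ((F.mapDerivedCategorySingleFunctor 0).app X)
      ((F.mapDerivedCategory.commShiftIso (n : ℤ)).app _ ≪≫
        (shiftFunctor _ (n : ℤ)).mapIso ((F.mapDerivedCategorySingleFunctor 0).app Y)))
  refine ⟨e.trans Ext.homEquiv.symm, ?_⟩
  ext ξ : 1
  apply Ext.homEquiv.injective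
  refine (Ext.mapExactFunctor_hom F ξ).trans ?_
  simp [e, ShiftedHom.map, Iso.homCongr]

lemma bijective_map_singleFunctor_iff (X Y : A) (n : ℕ) :
    Function.Bijective (F.mapDerivedCategory.map (X := (singleFunctor A 0).obj X)
      (Y := ((singleFunctor A 0).obj Y)⟦(n : ℤ)⟧)) ↔
      Function.Bijective (F.mapExtAddHom X Y n) := by
  obtain ⟨e, he⟩ := exists_equiv_comp_mapExtAddHom F X Y n
  rw [he, Equiv.comp_bijective]
  exact (Equiv.bijective_comp _ _).symm

lemma surjective_map_singleFunctor_iff (X Y : A) (n : ℕ) :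
    Function.Surjective (F.mapDerivedCategory.map (X := (singleFunctor A 0).obj X)
      (Y := ((singleFunctor A 0).obj Y)⟦(n : ℤ)⟧)) ↔
      Function.Surjective (F.mapExtAddHom X Y n) := by
  obtain ⟨e, he⟩ := exists_equiv_comp_mapExtAddHom F X Y n
  rw [he, Equiv.comp_surjective]
  exact (Equiv.surjective_comp _ _).symm

omit [HasDerivedCategory.{w₁} A] [HasDerivedCategory.{w₂} B] in
lemma bijective_mapExtAddHom_zero [F.Full] [F.Faithful] (X Y : A) :
    Function.Bijective (F.mapExtAddHom X Y 0) := by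
  simpa [Ext.mapExactFunctor₀] using ⟨F.map_injective, F.map_surjective⟩

variable {F}

/-- If `F` induces bijections on all Ext groups, then `F.mapDerivedCategory` induces bijections on
morphisms between shifts of objects placed in a single degree. -/
lemma shiftedHomBijective_singleFunctor
    (h : ∀ (X Y : A) (n : ℕ), Function.Bijective (F.mapExtAddHom X Y n)) (X Y : A) (i j : ℤ) :
    ShiftedHomBijective F.mapDerivedCategory ((singleFunctor A i).obj X)
      ((singleFunctor A j).obj Y) := by
  have key (m : ℤ) : Function.Bijective (F.mapDerivedCategory.map
      (X := (singleFunctor A 0).obj X) (Y := ((singleFunctor A 0).obj Y)⟦m⟧)) := by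
    obtain hm | hm := le_or_gt 0 m
    · lift m to ℕ using hm
      exact (bijective_map_singleFunctor_iff F X Y m).2 (h X Y m)
    · -- in negative degrees there are no nonzero morphisms, both in the source and in the target
      have : DerivedCategory.IsGE (((singleFunctor A 0).obj Y)⟦m⟧) (-m) :=
        t.isGE_shift _ 0 m (-m)
      have := isLE_mapDerivedCategory_obj F ((singleFunctor A 0).obj X) 0
      have := isGE_mapDerivedCategory_obj F (((singleFunctor A 0).obj Y)⟦m⟧) (-m)
      exact ⟨fun f g _ => (t.zero f 0 (-m)).trans (t.zero g 0 (-m)).symm,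
        fun f => ⟨0, (Functor.map_zero _ _ _).trans (t.zero f 0 (-m)).symm⟩⟩
  intro a b
  refine bijective_map_of_iso _ ?_ ?_ (bijective_map_shift _ (key (b - j - (a - i))) (a - i))
  · exact ((singleFunctors A).shiftIso (a - i) (i - a) 0 (by lia)).app X ≪≫
      (((singleFunctors A).shiftIso a (i - a) i (by lia)).app X).symm
  · exact ((shiftFunctorAdd' _ _ _ (b - j) (by lia)).app _).symm ≪≫
      ((singleFunctors A).shiftIso (b - j) (j - b) 0 (by lia)).app Y ≪≫
      (((singleFunctors A).shiftIso b (j - b) j (by lia)).app Y).symm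

lemma bijective_map_of_bounded
    (h : ∀ (X Y : A) (n : ℕ), Function.Bijective (F.mapExtAddHom X Y n)) {X Y : DerivedCategory A}
    (hX : t.bounded X) (hY : t.bounded Y) :
    Function.Bijective (F.mapDerivedCategory.map (X := X) (Y := Y)) := by
  have h₁ (N : A) (j : ℤ) :
      ShiftedHomBijective F.mapDerivedCategory X ((singleFunctor A j).obj N) := by
    let P : ObjectProperty (DerivedCategory A) := fun X =>
      ShiftedHomBijective F.mapDerivedCategory X ((singleFunctor A j).obj N)
    have : P.IsClosedUnderIsomorphisms := ⟨fun e h => h.of_iso e (Iso.refl _)⟩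
    exact bounded_induction ⊤ P (fun n M _ => shiftedHomBijective_singleFunctor h M N n j)
      (fun _ _ _ hΔ h₁ h₃ => .obj₂_left hΔ h₁ h₃) X hX (fun _ => trivial)
  let P : ObjectProperty (DerivedCategory A) := ShiftedHomBijective F.mapDerivedCategory X
  have : P.IsClosedUnderIsomorphisms := ⟨fun e h => h.of_iso (Iso.refl _) e⟩
  exact ShiftedHomBijective.bijective (bounded_induction ⊤ P (fun n N _ => h₁ N n)
    (fun _ _ _ hΔ h₁ h₃ => .obj₂_right hΔ h₁ h₃) Y hY (fun _ => trivial))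

/-- If `F` induces bijections on all Ext groups, then every bounded object of the target with
cohomology in the essential image of `F` comes from a bounded object of the source: extensions
lift because their classes do. -/
lemma exists_bounded_iso
    (h : ∀ (X Y : A) (n : ℕ), Function.Bijective (F.mapExtAddHom X Y n)) {Z : DerivedCategory B}
    (hZ : t.bounded Z) (hZ' : ∀ i, F.essImage ((homologyFunctor B i).obj Z)) :
    ∃ X : DerivedCategory A, t.bounded X ∧ Nonempty (F.mapDerivedCategory.obj X ≅ Z) := by
  have : F.essImage.ContainsZero :=
    ⟨_, F.map_isZero (isZero_zero A), F.obj_mem_essImage _⟩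
  let P : ObjectProperty (DerivedCategory B) := fun Z =>
    ∃ X : DerivedCategory A, t.bounded X ∧ Nonempty (F.mapDerivedCategory.obj X ≅ Z)
  have : P.IsClosedUnderIsomorphisms :=
    ⟨fun e ⟨X, hX, ⟨e'⟩⟩ => ⟨X, hX, ⟨e' ≪≫ e⟩⟩⟩
  refine bounded_induction F.essImage P ?_ ?_ Z hZ hZ'
  · rintro n M ⟨N, ⟨e⟩⟩
    exact ⟨(singleFunctor A n).obj N, ⟨⟨n, inferInstance⟩, ⟨n, inferInstance⟩⟩,
      ⟨(F.mapDerivedCategorySingleFunctor n).app N ≪≫ (singleFunctor B n).mapIso e⟩⟩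
  · rintro Z₁ Z₂ Z₃ f g δ hΔ ⟨X₁, hX₁, ⟨e₁⟩⟩ ⟨X₃, hX₃, ⟨e₃⟩⟩
    -- the connecting morphism `δ` lifts to some `w`, and the cone of `w` lifts that of `δ`
    have hX₁' : t.bounded (X₁⟦(1 : ℤ)⟧) := t.bounded.le_shift 1 _ hX₁
    let c : F.mapDerivedCategory.obj (X₁⟦(1 : ℤ)⟧) ≅ Z₁⟦(1 : ℤ)⟧ :=
      (F.mapDerivedCategory.commShiftIso (1 : ℤ)).app X₁ ≪≫ (shiftFunctor _ (1 : ℤ)).mapIso e₁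
    obtain ⟨w, hw⟩ := (bijective_map_of_bounded h hX₃ hX₁').2 (e₃.hom ≫ δ ≫ c.inv)
    obtain ⟨X₂, u, v, hΔ'⟩ := distinguished_cocone_triangle₂ w
    refine ⟨X₂, t.bounded.ext_of_isTriangulatedClosed₂ _ hΔ' hX₁ hX₃,
      ⟨Triangle.π₂.mapIso (isoTriangleOfIso₁₃ _ _ (map_distinguished_mk _ hΔ') hΔ e₁ e₃ ?_)⟩⟩
    have : F.mapDerivedCategory.map w ≫ c.hom = e₃.hom ≫ δ := by simp [hw]
    exact (Category.assoc _ _ _).trans this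

end Ext

end MapDerivedCategory

/-! ### Surjectivity on Ext groups from lifting of cones -/

section Surjective

open Pretriangulated DerivedCategory DerivedCategory.TStructure

universe w₁' w₂' w₁ w₂ v₁ v₂ u₁ u₂

variable {A : Type u₁} [Category.{v₁} A] [Abelian A] [HasDerivedCategory.{w₁} A]
  {B : Type u₂} [Category.{v₂} B] [Abelian B] [HasDerivedCategory.{w₂} B]
  (F : A ⥤ B) [F.Additive] [PreservesFiniteLimits F] [PreservesFiniteColimits F]

lemma surjective_map_of_isGE_of_isLE [F.Full] (a : ℤ) (X Y : DerivedCategory A)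
    [X.IsGE a] [X.IsLE a] [Y.IsGE a] [Y.IsLE a] :
    Function.Surjective (F.mapDerivedCategory.map (X := X) (Y := Y)) := by
  obtain ⟨M, ⟨e⟩⟩ := exists_iso_singleFunctor_obj_of_isGE_of_isLE X a
  obtain ⟨N, ⟨e'⟩⟩ := exists_iso_singleFunctor_obj_of_isGE_of_isLE Y a
  refine surjective_map_of_iso _ e.symm e'.symm fun f => ?_
  have := Functor.Full.of_iso (F.mapDerivedCategorySingleFunctor a).symm
  obtain ⟨g, hg⟩ := (singleFunctor A a ⋙ F.mapDerivedCategory).map_surjective f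
  exact ⟨_, hg⟩

/-- If every morphism from `F M` to `(F N)⟦n⟧⟦1⟧` comes from the source up to isomorphisms of
`F M` and of `(F N)⟦n⟧`, then it comes from the source, since these isomorphisms do, `F` being
full. -/
lemma surjective_map_of_lift [F.Full] [F.Faithful] (M N : A) (n : ℕ)
    (h : ∀ f : (singleFunctor B 0).obj (F.obj M) ⟶
        ((singleFunctor B 0).obj (F.obj N))⟦(n : ℤ)⟧⟦(1 : ℤ)⟧,
      ∃ (X₁ X₃ : DerivedCategory A) (w : X₃ ⟶ X₁⟦(1 : ℤ)⟧)
        (e₁ : F.mapDerivedCategory.obj X₁ ≅ ((singleFunctor B 0).obj (F.obj N))⟦(n : ℤ)⟧)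
        (e₃ : F.mapDerivedCategory.obj X₃ ≅ (singleFunctor B 0).obj (F.obj M)),
        F.mapDerivedCategory.map w ≫ (F.mapDerivedCategory.commShiftIso (1 : ℤ)).hom.app X₁ ≫
          e₁.hom⟦(1 : ℤ)⟧' = e₃.hom ≫ f) :
    Function.Surjective (F.mapDerivedCategory.map (X := (singleFunctor A 0).obj M)
      (Y := ((singleFunctor A 0).obj N)⟦((n + 1 : ℕ) : ℤ)⟧)) := by
  refine surjective_map_of_iso _ (Iso.refl _)
    ((shiftFunctorAdd' _ (n : ℤ) 1 ((n + 1 : ℕ) : ℤ) (by simp)).app _).symm fun f => ?_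
  let c₃ := (F.mapDerivedCategorySingleFunctor 0).app M
  let c₁ := (F.mapDerivedCategory.commShiftIso (n : ℤ)).app ((singleFunctor A 0).obj N) ≪≫
    (shiftFunctor _ (n : ℤ)).mapIso ((F.mapDerivedCategorySingleFunctor 0).app N)
  obtain ⟨X₁, X₃, w, e₁, e₃, hw⟩ := h (c₃.inv ≫ f ≫
    (F.mapDerivedCategory.commShiftIso (1 : ℤ)).hom.app _ ≫ c₁.hom⟦(1 : ℤ)⟧')
  have : DerivedCategory.IsGE (((singleFunctor A 0).obj N)⟦(n : ℤ)⟧) (-n) :=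
    t.isGE_shift _ 0 n (-n)
  have : DerivedCategory.IsLE (((singleFunctor A 0).obj N)⟦(n : ℤ)⟧) (-n) :=
    t.isLE_shift _ 0 n (-n)
  have := isGE_mapDerivedCategory_obj F (((singleFunctor A 0).obj N)⟦(n : ℤ)⟧) (-n)
  have := isLE_mapDerivedCategory_obj F (((singleFunctor A 0).obj N)⟦(n : ℤ)⟧) (-n)
  have := isGE_mapDerivedCategory_obj F ((singleFunctor A 0).obj M) 0
  have := isLE_mapDerivedCategory_obj F ((singleFunctor A 0).obj M) 0
  let i₁ : F.mapDerivedCategory.obj X₁ ≅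
    F.mapDerivedCategory.obj (((singleFunctor A 0).obj N)⟦(n : ℤ)⟧) := e₁ ≪≫ c₁.symm
  let i₃ : F.mapDerivedCategory.obj ((singleFunctor A 0).obj M) ≅
    F.mapDerivedCategory.obj X₃ := c₃ ≪≫ e₃.symm
  -- `X₁` is concentrated in degree `-n` and `X₃` in degree `0`, so that `i₁` and `i₃` lift
  have : DerivedCategory.IsGE (F.mapDerivedCategory.obj X₁) (-n) := t.isGE_of_iso i₁.symm _
  have : DerivedCategory.IsLE (F.mapDerivedCategory.obj X₁) (-n) := t.isLE_of_iso i₁.symm _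
  have : DerivedCategory.IsGE (F.mapDerivedCategory.obj X₃) 0 := t.isGE_of_iso i₃ _
  have : DerivedCategory.IsLE (F.mapDerivedCategory.obj X₃) 0 := t.isLE_of_iso i₃ _
  have := isGE_of_isGE_mapDerivedCategory_obj F X₁ (-n)
  have := isLE_of_isLE_mapDerivedCategory_obj F X₁ (-n)
  have := isGE_of_isGE_mapDerivedCategory_obj F X₃ 0
  have := isLE_of_isLE_mapDerivedCategory_obj F X₃ 0
  obtain ⟨α, hα⟩ := surjective_map_of_isGE_of_isLE F 0 _ _ i₃.hom
  obtain ⟨β, hβ⟩ := surjective_map_of_isGE_of_isLE F (-n) _ _ i₁.hom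
  refine ⟨α ≫ w ≫ β⟦(1 : ℤ)⟧', ?_⟩
  have hβ' := (F.mapDerivedCategory.commShiftIso (1 : ℤ)).hom.naturality β
  dsimp at hβ'
  rw [← cancel_mono ((F.mapDerivedCategory.commShiftIso (1 : ℤ)).hom.app _),
    ← cancel_mono (c₁.hom⟦(1 : ℤ)⟧')]
  simp only [Functor.map_comp, Category.assoc, reassoc_of% hβ', hα, hβ]
  simp only [i₁, i₃, Iso.trans_hom, Iso.symm_hom, Category.assoc,
    ← Functor.map_comp, Iso.inv_hom_id, Category.comp_id, hw]
  simp

/-- If every bounded object of the target with cohomology in the essential image of `F` comes from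
the source, then `F.mapDerivedCategory` is surjective on morphisms of degree at least `2` between
objects placed in degree `0`: the cone of such a morphism comes from an object of the source, and
the morphism is the connecting morphism of the truncation triangle of this cone. -/
lemma surjective_map_of_exists_iso [F.Full] [F.Faithful]
    (h : ∀ Z : DerivedCategory B, t.bounded Z →
      (∀ i, F.essImage ((homologyFunctor B i).obj Z)) →
        ∃ X : DerivedCategory A, Nonempty (F.mapDerivedCategory.obj X ≅ Z))
    (M N : A) (n : ℕ) (hn : 1 ≤ n) :
    Function.Surjective (F.mapDerivedCategory.map (X := (singleFunctor A 0).obj M)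
      (Y := ((singleFunctor A 0).obj N)⟦((n + 1 : ℕ) : ℤ)⟧)) := by
  have : F.essImage.ContainsZero :=
    ⟨_, F.map_isZero (isZero_zero A), F.obj_mem_essImage _⟩
  refine surjective_map_of_lift F M N n fun f => ?_
  obtain ⟨Z, u, v, hΔ⟩ := distinguished_cocone_triangle₂ f
  have hM₀ : ((singleFunctor B 0).obj (F.obj M)).IsGE 0 := inferInstance
  have hM₀' : ((singleFunctor B 0).obj (F.obj M)).IsLE 0 := inferInstance
  have hN₀ : DerivedCategory.IsGE (((singleFunctor B 0).obj (F.obj N))⟦(n : ℤ)⟧) (-n) :=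
    t.isGE_shift _ 0 n (-n)
  have hN₀' : DerivedCategory.IsLE (((singleFunctor B 0).obj (F.obj N))⟦(n : ℤ)⟧) (-n) :=
    t.isLE_shift _ 0 n (-n)
  -- as `n ≥ 1`, the triangle on `f` is the truncation triangle of `Z` in degrees `≤ -1` and `≥ 0`
  have hN₁ : DerivedCategory.IsLE (((singleFunctor B 0).obj (F.obj N))⟦(n : ℤ)⟧) (-1) :=
    t.isLE_of_le _ (-n) (-1)
  have hZ : t.bounded Z := t.bounded.ext_of_isTriangulatedClosed₂ _ hΔ
    ⟨⟨-n, hN₀⟩, ⟨-n, hN₀'⟩⟩ ⟨⟨0, hM₀⟩, ⟨0, hM₀'⟩⟩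
  obtain ⟨X, ⟨e⟩⟩ := h Z hZ ((homology_mem_iff_of_distinguished F.essImage hΔ (-1) 0 (by lia)).2
    ⟨fun i => F.essImage.prop_of_iso ((homologyFunctor B i).mapIso
        (((singleFunctors B).shiftIso (n : ℤ) (-n) 0 (by lia)).app (F.obj N)).symm)
        (homology_singleFunctor_obj_mem _ (F.obj_mem_essImage N) _ _),
      homology_singleFunctor_obj_mem _ (F.obj_mem_essImage M) 0⟩)
  have : DerivedCategory.IsLE ((t.triangleLTGE 0).obj X).obj₁ (-1) := t.isLE_truncLT_obj _ _ _
  have : DerivedCategory.IsGE ((t.triangleLTGE 0).obj X).obj₃ 0 := t.isGE_truncGE_obj _ _ _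
  obtain ⟨e', -⟩ := t.triangle_iso_exists
    (F.mapDerivedCategory.map_distinguished _ (t.triangleLTGE_distinguished 0 X)) hΔ e (-1) 0
    (isLE_mapDerivedCategory_obj F _ _) (isGE_mapDerivedCategory_obj F _ _)
    hN₁ hM₀
  refine ⟨_, _, ((t.triangleLTGE 0).obj X).mor₃, Triangle.π₁.mapIso e', Triangle.π₃.mapIso e', ?_⟩
  exact (Category.assoc _ _ _).symm.trans e'.hom.comm₃

/-- If the essential image of `F` is closed under extensions, then `F.mapDerivedCategory` is
surjective on morphisms of degree `1` between objects placed in degree `0`: the cone of such a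
morphism is an extension. -/
lemma surjective_map_one [F.Full] [F.Faithful] [F.essImage.IsClosedUnderExtensions] (M N : A) :
    Function.Surjective (F.mapDerivedCategory.map (X := (singleFunctor A 0).obj M)
      (Y := ((singleFunctor A 0).obj N)⟦((0 + 1 : ℕ) : ℤ)⟧)) := by
  refine surjective_map_of_lift F M N 0 fun f => ?_
  obtain ⟨Z, u, v, hΔ⟩ := distinguished_cocone_triangle₂ f
  let iN : ((singleFunctor B 0).obj (F.obj N))⟦((0 : ℕ) : ℤ)⟧ ≅ (singleFunctor B 0).obj (F.obj N) :=
    ((singleFunctors B).shiftIso ((0 : ℕ) : ℤ) 0 0 (by simp)).app (F.obj N)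
  have hM₀ : ((singleFunctor B 0).obj (F.obj M)).IsGE 0 := inferInstance
  have hM₀' : ((singleFunctor B 0).obj (F.obj M)).IsLE 0 := inferInstance
  have hN₀ : DerivedCategory.IsGE (((singleFunctor B 0).obj (F.obj N))⟦((0 : ℕ) : ℤ)⟧) 0 :=
    t.isGE_of_iso iN.symm 0
  have hN₀' : DerivedCategory.IsLE (((singleFunctor B 0).obj (F.obj N))⟦((0 : ℕ) : ℤ)⟧) 0 :=
    t.isLE_of_iso iN.symm 0
  have : Z.IsGE 0 := t.isGE₂ _ hΔ 0 hN₀ hM₀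
  have : Z.IsLE 0 := t.isLE₂ _ hΔ 0 hN₀' hM₀'
  -- all the objects of the triangle are in degree `0`: it is a short exact sequence
  have hS : (ShortComplex.mk ((homologyFunctor B 0).map u) ((homologyFunctor B 0).map v) (by
      rw [← Functor.map_comp]
      exact ((homologyFunctor B 0).congr_map (comp_distTriang_mor_zero₁₂ _ hΔ)).trans
        (Functor.map_zero _ _ _))).ShortExact :=
    { exact := HomologySequence.exact₂ _ hΔ 0
      mono_f := (HomologySequence.mono_homologyMap_mor₁_iff _ hΔ (-1) 0 (by lia)).2
        ((isZero_of_isGE ((singleFunctor B 0).obj (F.obj M)) 0 (-1) (by lia)).eq_of_src _ _)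
      epi_g := (HomologySequence.epi_homologyMap_mor₂_iff _ hΔ 0 1 (by lia)).2
        ((isZero_of_isLE (((singleFunctor B 0).obj (F.obj N))⟦((0 : ℕ) : ℤ)⟧) 0 1
          (by lia)).eq_of_tgt _ _) }
  obtain ⟨E, ⟨e⟩⟩ : F.essImage ((homologyFunctor B 0).obj Z) :=
    F.essImage.prop_X₂_of_shortExact hS
      ⟨N, ⟨(singleFunctorCompHomologyFunctorIso B 0).symm.app (F.obj N) ≪≫
        (homologyFunctor B 0).mapIso iN.symm⟩⟩
      ⟨M, ⟨(singleFunctorCompHomologyFunctorIso B 0).symm.app (F.obj M)⟩⟩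
  obtain ⟨E', ⟨e'⟩⟩ := exists_iso_singleFunctor_obj_of_isGE_of_isLE Z 0
  let iE : F.mapDerivedCategory.obj ((singleFunctor A 0).obj E) ≅ Z :=
    (F.mapDerivedCategorySingleFunctor 0).app E ≪≫ (singleFunctor B 0).mapIso (e ≪≫
      (homologyFunctor B 0).mapIso e' ≪≫ (singleFunctorCompHomologyFunctorIso B 0).app E') ≪≫
      e'.symm
  let iN' : F.mapDerivedCategory.obj ((singleFunctor A 0).obj N) ≅
      ((singleFunctor B 0).obj (F.obj N))⟦((0 : ℕ) : ℤ)⟧ :=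
    (F.mapDerivedCategorySingleFunctor 0).app N ≪≫ iN.symm
  obtain ⟨u', hu'⟩ := surjective_map_of_isGE_of_isLE F 0 _ _ (iN'.hom ≫ u ≫ iE.inv)
  obtain ⟨X₃, v', w', hΔ'⟩ := distinguished_cocone_triangle u'
  let e'' := isoTriangleOfIso₁₂ _ _ (map_distinguished_mk F.mapDerivedCategory hΔ') hΔ iN' iE
    (show F.mapDerivedCategory.map u' ≫ iE.hom = iN'.hom ≫ u by simp [hu'])
  refine ⟨_, X₃, w', Triangle.π₁.mapIso e'', Triangle.π₃.mapIso e'', ?_⟩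
  exact (Category.assoc _ _ _).symm.trans e''.hom.comm₃

end Surjective

/-! ### The equivalence for finite-dimensional modules -/

section

open DerivedCategory DerivedCategory.TStructure

variable (k : Type w) [Field k] (B : Type u) [Ring B] [Algebra k B]

lemma essImage_incl : (incl k B).essImage = isFinDim k B := by
  ext M
  exact ⟨fun ⟨N, ⟨e⟩⟩ => (isFinDim k B).prop_of_iso e N.property,
    fun h => ⟨⟨M, h⟩, ⟨Iso.refl _⟩⟩⟩

instance essImage_incl_isClosedUnderExtensions :
    (incl k B).essImage.IsClosedUnderExtensions := by
  rw [essImage_incl]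
  infer_instance

variable {k B}

/-- Surjectivity in degrees at least `2` implies that all the maps between Ext groups are bijective:
those on `Ext^0` and `Ext^1` are bijective without any assumption, and bijectivity in one degree
gives injectivity in the next one. -/
lemma bijective_extMap_of_surjective
    (h : ∀ (M N : FDMod k B) (n : ℕ), 2 ≤ n → Function.Surjective (extMap k B M N n)) (n : ℕ) :
    ∀ M N : FDMod k B, Function.Bijective (extMap k B M N n) := by
  induction n with
  | zero => exact bijective_mapExtAddHom_zero (incl k B)
  | succ n hn =>
    refine fun M N => ⟨injective_mapExtAddHom_succ (incl k B) n hn M N, ?_⟩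
    obtain rfl | hn' := Nat.eq_zero_or_pos n
    · exact (surjective_map_singleFunctor_iff (incl k B) M N _).1
        (surjective_map_one (incl k B) M N)
    · exact h M N (n + 1) (by lia)

lemma surjective_extMap_of_essSurj (h : (boundedIncl k B).EssSurj) (M N : FDMod k B) (n : ℕ)
    (hn : 2 ≤ n) : Function.Surjective (extMap k B M N n) := by
  obtain ⟨n, rfl⟩ : ∃ m, n = m + 1 := ⟨n - 1, by lia⟩
  refine (surjective_map_singleFunctor_iff (incl k B) M N (n + 1)).1
    (surjective_map_of_exists_iso (incl k B) (fun Z hZ hZ' => ?_) M N n (by lia))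
  rw [essImage_incl] at hZ'
  obtain ⟨X, ⟨e⟩⟩ := h.mem_essImage (⟨Z, hZ, hZ'⟩ : BoundedFD k B)
  exact ⟨X.obj, ⟨(isBoundedFD k B).ι.mapIso e⟩⟩

lemma isEquivalence_boundedIncl
    (h : ∀ (M N : FDMod k B) (n : ℕ), Function.Bijective (extMap k B M N n)) :
    (boundedIncl k B).IsEquivalence := by
  have h' {X Y : DerivedCategory.Bounded (FDMod k B)} :=
    bijective_map_of_bounded (F := incl k B) h X.property Y.property
  exact
    { faithful := ⟨fun {X Y f g} hfg => by
        ext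
        exact h'.1 (congr_arg (isBoundedFD k B).ι.map hfg)⟩
      full := ⟨fun {X Y} f => by
        obtain ⟨g, hg⟩ := h'.2 ((isBoundedFD k B).ι.map f)
        exact ⟨ObjectProperty.homMk g, (isBoundedFD k B).ι.map_injective hg⟩⟩
      essSurj := ⟨fun Z => by
        have hZ := Z.property.2
        rw [← essImage_incl] at hZ
        obtain ⟨X, hX, ⟨e⟩⟩ := exists_bounded_iso (F := incl k B) h Z.property.1 hZ
        exact ⟨⟨X, hX⟩, ⟨(isBoundedFD k B).isoMk e⟩⟩⟩ }

end

end FinDimMod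

theorem mainTheorem10 (k : Type w) [Field k] (B : Type u) [Ring B] [Algebra k B] :
    List.TFAE [
      (FinDimMod.boundedIncl k B).IsEquivalence,
      (FinDimMod.boundedIncl k B).EssSurj,
      ∀ (M N : FinDimMod.FDMod k B) (n : ℕ), 1 ≤ n →
        Function.Bijective (FinDimMod.extMap k B M N n),
      ∀ (M N : FinDimMod.FDMod k B) (n : ℕ), 2 ≤ n →
        Function.Surjective (FinDimMod.extMap k B M N n)] := by
  tfae_have 1 → 2 := fun h => h.essSurj
  tfae_have 2 → 4 := FinDimMod.surjective_extMap_of_essSurj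
  tfae_have 4 → 3 := fun h M N n _ => FinDimMod.bijective_extMap_of_surjective h n M N
  tfae_have 3 → 1 := fun h => FinDimMod.isEquivalence_boundedIncl
    fun M N n => FinDimMod.bijective_extMap_of_surjective
      (fun M N n hn => (h M N n (by lia)).2) n M N
  tfae_finish
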